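/- **Setting.** Let $F:\mathbb R\to(0,1)$ be the (known) CDF of a probability distribution on $\mathbb R$ such that $F\in C^2$ is strictly increasing, $\log F$ and $\log(1-F)$ are strictly concave, and $f=F'$ and $f'$ are bounded. For a price $v$ and an expected valuation $u$ let $g(v,u)=v\,(1-F(v-u))$ be the expected reward and $J(u)=\arg\max_{v\in\mathbb R} g(v,u)$ the greedy price. Let $B_1,B_2>0$, $B=B_1B_2$, let $\mathbb H\subseteq\{\theta\in\mathbb R^d:\|\theta\|_2\le B_1\}$ be closed and convex, and let $D\subseteq\{x\in\mathbb R^d:\|x\|_2\le B_2\}$ be such that $0\le x^\top\theta\le B$ for all $x\in D$, $\theta\in\mathbb H$. An unknown $\theta^*\in\mathbb H$ and an arbitrary sequence $x_1,x_2,\dots\in D$ (chosen by an oblivious adversary) are fixed; the noises $N_1,N_2,\dots$ are i.i.d. with CDF $F$. In round $t$ the seller sees $x_t$, posts a price $v_t$ depending on $x_t$ and on the past, and observes $\mathbf 1_t=\mathbf 1(v_t\le x_t^\top\theta^*+N_t)$. The regret is $$Reg=\sum_{t=1}^T\Big(\max_v g(v,x_t^\top\theta^*)-g(v_t,x_t^\top\theta^*)\Big).$$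 **Algorithm ONSP** with parameters $\gamma,\epsilon>0$ and $\theta_1\in\mathbb H$: put $A_0=\epsilon I_d$; in round $t$ post $v_t=J(x_t^\top\theta_t)$, let $l_t(\theta)=-\mathbf 1_t\log(1-F(v_t-x_t^\top\theta))-(1-\mathbf 1_t)\log F(v_t-x_t^\top\theta)$ and $\nabla_t=\nabla l_t(\theta_t)$, and set $$A_t=A_{t-1}+\nabla_t\nabla_t^\top,\qquad \hat\theta_{t+1}=\theta_t-\tfrac1\gamma A_t^{-1}\nabla_t,\qquad \theta_{t+1}=\arg\min_{\theta\in\mathbb H}(\theta-\hat\theta_{t+1})^\top A_t(\theta-\hat\theta_{t+1}).$$ The parameters are determined by a number $\alpha>0$ through $\gamma=\frac12\min\{\frac1{4G\Delta},\alpha\}$ and $\epsilon=\frac1{\gamma^2\Delta^2}$, where $\Delta=2B_1$, $G=\sqrt{C_{\exp}}\,B_2$. Here $$C_{\exp}=\sup_{\omega\in[-B,B+J(0)]}\max\Big\{\tfrac{f(\omega)^2}{F(\omega)^2},\tfrac{f(\omega)^2}{(1-F(\omega))^2}\Big\},\quad C_{\mathrm{down}}=\inf_{\omega\in[-B,B+J(0)]}\min\big\{-(\log(1-F))''(\omega),-(\log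 F)''(\omega)\big\}.$$ **Theorem.** For every such $F$ and every $B>0$ there are $\alpha>0$ and $C_a>0$, depending only on $F$ and $B$, where $\alpha=C_{\mathrm{down}}/C_{\exp}$ whenever $C_{\mathrm{down}}>0$ (in particular whenever $(\log F)''$ and $(\log(1-F))''$ are everywhere negative), such that for all $d$, all $B_1,B_2>0$ with $B_1B_2=B$, and all $\mathbb H,D,\theta^*,\theta_1,(x_t)$ as above, and all $T\ge2$, the regret of ONSP with these parameters is integrable and $$\mathbb E_{N_1,\dots,N_T}[Reg_{\mathrm{ONSP}}]\le C_a\cdot d\log T .$$ -/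

import Mathlib

noncomputable section

namespace Pricing

/-- Vectors in `ℝ^d` with the Euclidean norm. -/
abbrev Vec (d : ℕ) : Type := EuclideanSpace ℝ (Fin d)

/-- Regularity and shape assumptions on the CDF `F` of the noise: twice continuously
differentiable, strictly increasing, `F` and `1 - F` strictly log-concave, and the density
`f = F'` and its derivative `f'` bounded. -/
structure NoiseAssumption (F : ℝ → ℝ) : Prop where
  contDiff : ContDiff ℝ 2 F
  strictMono : StrictMono F
  strictLogConcave : StrictConcaveOn ℝ Set.univ (fun y => Real.log (F y))
  strictLogConcave_compl : StrictConcaveOn ℝ Set.univ (fun y => Real.log (1 - F y))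
  bddAbove_density : BddAbove (Set.range (fun y => |deriv F y|))
  bddAbove_deriv_density : BddAbove (Set.range (fun y => |deriv (deriv F) y|))

/-- Expected reward of the price `v` when the expected valuation is `u`. -/
def expReward (F : ℝ → ℝ) (v u : ℝ) : ℝ := v * (1 - F (v - u))

/-- Greedy price: a maximizer over all `v` of the expected reward at expected valuation `u`. -/
def greedyPrice (F : ℝ → ℝ) (u : ℝ) : ℝ :=
  Classical.epsilon (fun v => ∀ w : ℝ, expReward F w u ≤ expReward F v u)

/-- Data of past rounds `(feature, price, accepted?)`, most recent round first. -/
abbrev Transcript (d : ℕ) : Type := List (Vec d × ℝ × Bool)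

/-- A pricing policy: the price as a function of the current feature and the past transcript. -/
abbrev Policy (d : ℕ) : Type := Vec d → Transcript d → ℝ

/-- The transcript of the first `t` rounds. In the round with index `t` (the `(t+1)`-st round) the
feature is `x t`, the noise is `n t`, the valuation is `⟨x t, θ⟩ + n t`, and the product is sold
iff the price is at most the valuation. -/
def hist {d : ℕ} (𝒜 : Policy d) (x : ℕ → Vec d) (θ : Vec d) (n : ℕ → ℝ) : ℕ → Transcript d
  | 0 => []
  | t + 1 =>
    let h := hist 𝒜 x θ n t
    let v := 𝒜 (x t) h
    (x t, v, decide (v ≤ inner ℝ (x t) θ + n t)) :: h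

/-- Regret after `T` rounds of the policy `𝒜`, for the noise realization `n` (it is a random
variable through the prices): sum of the gaps in expected reward to the best price that knows the
true parameter `θ`. -/
def regret {d : ℕ} (F : ℝ → ℝ) (𝒜 : Policy d) (x : ℕ → Vec d) (θ : Vec d) (n : ℕ → ℝ) (T : ℕ) :
    ℝ :=
  ∑ t ∈ Finset.range T,
    ((⨆ v : ℝ, expReward F v (inner ℝ (x t) θ)) -
      expReward F (𝒜 (x t) (hist 𝒜 x θ n t)) (inner ℝ (x t) θ))

/-- Negative log-likelihood of the parameter `θ` given feature, price and sale indicator. -/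
def negLogLik {d : ℕ} (F : ℝ → ℝ) (x : Vec d) (v : ℝ) (b : Bool) (θ : Vec d) : ℝ :=
  if b then -Real.log (1 - F (v - inner ℝ x θ)) else -Real.log (F (v - inner ℝ x θ))

/-- `(y - z)ᵀ A (y - z)`. -/
def sqDist {d : ℕ} (A : Matrix (Fin d) (Fin d) ℝ) (y z : Vec d) : ℝ :=
  (y - z).ofLp ⬝ᵥ A.mulVec (y - z).ofLp

/-- Projection onto `H` in the norm given by `A`: a point of `H` minimizing `sqDist A · z`. -/
def proj {d : ℕ} (H : Set (Vec d)) (A : Matrix (Fin d) (Fin d) ℝ) (z : Vec d) : Vec d :=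
  Classical.epsilon (fun y => y ∈ H ∧ ∀ y' ∈ H, sqDist A y z ≤ sqDist A y' z)

/-- One update of the state `(θ_t, A_{t-1})` of the Online Newton Step after a round with feature
`x`, price `v` and sale indicator `b`. -/
def onsUpdate {d : ℕ} (F : ℝ → ℝ) (H : Set (Vec d)) (γ : ℝ)
    (s : Vec d × Matrix (Fin d) (Fin d) ℝ) (x : Vec d) (v : ℝ) (b : Bool) :
    Vec d × Matrix (Fin d) (Fin d) ℝ :=
  let grad : Vec d := gradient (negLogLik F x v b) s.1
  let A := s.2 + Matrix.vecMulVec grad.ofLp grad.ofLp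
  (proj H A (s.1 - (1 / γ) • WithLp.toLp 2 (A⁻¹.mulVec grad.ofLp)), A)

/-- State `(θ_t, A_{t-1})` of the Online Newton Step after a transcript, started at
`(θ₁, ε • I)`. -/
def onsState {d : ℕ} (F : ℝ → ℝ) (H : Set (Vec d)) (θ₁ : Vec d) (γ ε : ℝ) :
    Transcript d → Vec d × Matrix (Fin d) (Fin d) ℝ
  | [] => (θ₁, ε • (1 : Matrix (Fin d) (Fin d) ℝ))
  | (x, v, b) :: h => onsUpdate F H γ (onsState F H θ₁ γ ε h) x v b

/-- Online-Newton-Step pricing: charge the greedy price at the current estimate of the expected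
valuation. -/
def onsp {d : ℕ} (F : ℝ → ℝ) (H : Set (Vec d)) (θ₁ : Vec d) (γ ε : ℝ) : Policy d :=
  fun x h => greedyPrice F (inner ℝ x (onsState F H θ₁ γ ε h).1)

/-- `inf` over `[-B, B + J(0)]` of `min {-(log (1 - F))'', -(log F)''}`. -/
def Cdown (F : ℝ → ℝ) (B : ℝ) : ℝ :=
  sInf ((fun y => min (-deriv (deriv (fun z => Real.log (1 - F z))) y)
      (-deriv (deriv (fun z => Real.log (F z))) y)) '' Set.Icc (-B) (B + greedyPrice F 0))

/-- `sup` over `[-B, B + J(0)]` of `max {f² / F², f² / (1 - F)²}`. -/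
def Cexp (F : ℝ → ℝ) (B : ℝ) : ℝ :=
  sSup ((fun y => max (deriv F y ^ 2 / F y ^ 2) (deriv F y ^ 2 / (1 - F y) ^ 2)) ''
      Set.Icc (-B) (B + greedyPrice F 0))

/-- Step parameter `γ = ½ min {1 / (4 G D), α}` with `G = √C_exp · B₂` and `D = 2 B₁`. -/
def stepGamma (F : ℝ → ℝ) (α B₁ B₂ : ℝ) : ℝ :=
  (1 / 2) * min (1 / (4 * (Real.sqrt (Cexp F (B₁ * B₂)) * B₂) * (2 * B₁))) α

/-- Initialization parameter `ε = 1 / (γ² D²)` with `D = 2 B₁`. -/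
def initEps (γ B₁ : ℝ) : ℝ := 1 / (γ ^ 2 * (2 * B₁) ^ 2)

end Pricing

end

/-! Write `u = ⟨x, θ_t⟩` and `u' = ⟨x, θ*⟩`. Three estimates meet in `(u - u') ^ 2`.

Reward: the derivative of the reward vanishes at the optimal price and the greedy price is
1-Lipschitz in the valuation, so posting `J(u)` instead of `J(u')` loses at most `C (u - u')²`
(`exists_reward_gap_le`).

Information: averaged over the sale, the slope of the loss at `u`, times `u - u'`, is at least `c (u
- u')²` (`exists_score_lower_bound`), with `c = C_down` if that is positive and the squared minimum
of the density otherwise.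

Optimization: along every path a Newton step lowers the potential `γ ‖θ_t - θ*‖²_A - (1/γ) log det
A` by at least `2⟨∇, θ_t - θ*⟩ - γ⟨∇, θ_t - θ*⟩²` (`onsPotential_step`). Since `γ C_exp ≤ c`, the
quadratic term costs at most `c (u - u')²`, while the linear term averages to at least `2c (u -
u')²`. Exp-concavity of the individual losses is not needed.

Hence the expected regret is at most `C / c` times the expected total drop of the potential, and
trace bounds on `log det A` make this drop `O(d log T)`. -/

noncomputable section

/-! ### Noise distribution, greedy price and the quadratic reward gap. -/

namespace Pricing

/-- A noise distribution as in `NoiseAssumption` whose CDF takes values in `(0, 1)`. -/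
structure RegularNoise (F : ℝ → ℝ) : Prop extends NoiseAssumption F where
  pos : ∀ y, 0 < F y
  lt_one : ∀ y, F y < 1

/-- Reciprocal of the hazard rate. -/
def invHazard (F : ℝ → ℝ) (y : ℝ) : ℝ := (1 - F y) / deriv F y

lemma mul_sq_le_of_le_deriv {φ : ℝ → ℝ} (hφ : Differentiable ℝ φ) {a b c : ℝ}
    (hc : ∀ y ∈ Set.Icc a b, c ≤ deriv φ y) {x y : ℝ} (hx : x ∈ Set.Icc a b)
    (hy : y ∈ Set.Icc a b) : c * (y - x) ^ 2 ≤ (φ y - φ x) * (y - x) := by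
  have key : ∀ x ∈ Set.Icc a b, ∀ y ∈ Set.Icc a b, x ≤ y → c * (y - x) ≤ φ y - φ x :=
    (convex_Icc a b).mul_sub_le_image_sub_of_le_deriv hφ.continuous.continuousOn
      hφ.differentiableOn (fun z hz => hc z (interior_subset hz))
  rcases le_total x y with h | h
  · nlinarith [key x hx y hy h]
  · nlinarith [key y hy x hx h]

namespace RegularNoise

variable {F : ℝ → ℝ}

lemma hasDerivAt (hF : RegularNoise F) (y : ℝ) : HasDerivAt F (deriv F y) y :=
  (hF.contDiff.differentiable (by norm_num) y).hasDerivAt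

lemma hasDerivAt_deriv (hF : RegularNoise F) (y : ℝ) :
    HasDerivAt (deriv F) (deriv (deriv F) y) y :=
  (hF.contDiff.differentiable_deriv_two y).hasDerivAt

lemma continuous (hF : RegularNoise F) : Continuous F := hF.contDiff.continuous

lemma continuous_deriv (hF : RegularNoise F) : Continuous (deriv F) :=
  hF.contDiff.differentiable_deriv_two.continuous

lemma compl_pos (hF : RegularNoise F) (y : ℝ) : 0 < 1 - F y := sub_pos.2 (hF.lt_one y)

lemma hasDerivAt_log (hF : RegularNoise F) (y : ℝ) :
    HasDerivAt (fun z => Real.log (F z)) (deriv F y / F y) y :=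
  (hF.hasDerivAt y).log (hF.pos y).ne'

lemma hasDerivAt_log_compl (hF : RegularNoise F) (y : ℝ) :
    HasDerivAt (fun z => Real.log (1 - F z)) (-(deriv F y / (1 - F y))) y := by
  have := ((hF.hasDerivAt y).const_sub 1).log (hF.compl_pos y).ne'
  rwa [neg_div] at this

lemma deriv_log (hF : RegularNoise F) :
    deriv (fun z => Real.log (F z)) = fun y => deriv F y / F y :=
  funext fun y => (hF.hasDerivAt_log y).deriv

lemma deriv_log_compl (hF : RegularNoise F) :
    deriv (fun z => Real.log (1 - F z)) = fun y => -(deriv F y / (1 - F y)) :=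
  funext fun y => (hF.hasDerivAt_log_compl y).deriv

lemma strictAnti_reversedHazard (hF : RegularNoise F) :
    StrictAnti fun y => deriv F y / F y := by
  have := hF.strictLogConcave.strictAntiOn_deriv
    (fun y _ => (hF.hasDerivAt_log y).differentiableAt)
  rw [hF.deriv_log] at this
  exact fun a b h => this (Set.mem_univ a) (Set.mem_univ b) h

lemma strictMono_hazard (hF : RegularNoise F) :
    StrictMono fun y => deriv F y / (1 - F y) := by
  have := hF.strictLogConcave_compl.strictAntiOn_deriv
    (fun y _ => (hF.hasDerivAt_log_compl y).differentiableAt)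
  rw [hF.deriv_log_compl] at this
  exact fun a b h => neg_lt_neg_iff.1 (this (Set.mem_univ a) (Set.mem_univ b) h)

/-- The ratio `f / F` is strictly decreasing and nonnegative, so it never reaches zero. -/
lemma density_pos (hF : RegularNoise F) (y : ℝ) : 0 < deriv F y := by
  have h1 : deriv F (y + 1) / F (y + 1) < deriv F y / F y :=
    hF.strictAnti_reversedHazard (lt_add_one y)
  have h2 : 0 ≤ deriv F (y + 1) / F (y + 1) :=
    div_nonneg hF.strictMono.monotone.deriv_nonneg (hF.pos _).le
  have h3 := mul_pos (h2.trans_lt h1) (hF.pos y)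
  rwa [div_mul_cancel₀ _ (hF.pos y).ne'] at h3

lemma differentiable_reversedHazard (hF : RegularNoise F) :
    Differentiable ℝ fun y => deriv F y / F y := fun y =>
  ((hF.hasDerivAt_deriv y).div (hF.hasDerivAt y) (hF.pos y).ne').differentiableAt

lemma differentiable_hazard (hF : RegularNoise F) :
    Differentiable ℝ fun y => deriv F y / (1 - F y) := fun y =>
  ((hF.hasDerivAt_deriv y).div ((hF.hasDerivAt y).const_sub 1) (hF.compl_pos y).ne').differentiableAt

lemma strictAnti_invHazard (hF : RegularNoise F) : StrictAnti (invHazard F) := by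
  intro a b h
  have h1 : deriv F a / (1 - F a) < deriv F b / (1 - F b) := hF.strictMono_hazard h
  have h2 := one_div_lt_one_div_of_lt (div_pos (hF.density_pos a) (hF.compl_pos a)) h1
  simpa [invHazard, one_div_div] using h2

lemma invHazard_pos (hF : RegularNoise F) (y : ℝ) : 0 < invHazard F y :=
  div_pos (hF.compl_pos y) (hF.density_pos y)

lemma continuous_invHazard (hF : RegularNoise F) : Continuous (invHazard F) :=
  (continuous_const.sub hF.continuous).div hF.continuous_deriv fun y => (hF.density_pos y).ne'

/-- This fixed point is the first-order condition for the price. A decreasing function minus the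
identity changes sign between `0` and its own value at `v = 0`. -/
lemma exists_invHazard_eq (hF : RegularNoise F) (u : ℝ) : ∃ v, invHazard F (v - u) = v := by
  have hcont : Continuous fun v => invHazard F (v - u) - v :=
    (hF.continuous_invHazard.comp (continuous_id.sub continuous_const)).sub continuous_id
  have hb : 0 < invHazard F (0 - u) := hF.invHazard_pos _
  have h1 : invHazard F (invHazard F (0 - u) - u) < invHazard F (0 - u) :=
    hF.strictAnti_invHazard (by linarith)
  obtain ⟨v, -, hv⟩ := intermediate_value_Icc' hb.le hcont.continuousOn
    (show (0 : ℝ) ∈ Set.Icc _ _ from ⟨by linarith, by linarith⟩)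
  exact ⟨v, by linarith⟩

lemma hasDerivAt_expReward (hF : RegularNoise F) (u v : ℝ) :
    HasDerivAt (fun v => expReward F v u) (1 - F (v - u) - v * deriv F (v - u)) v := by
  have h1 : HasDerivAt (fun v => F (v - u)) (deriv F (v - u)) v :=
    (hF.hasDerivAt (v - u)).comp_sub_const v u
  have h2 := (hasDerivAt_id v).mul (h1.const_sub 1)
  convert! h2 using 1
  simp
  ring

/-- The second factor is strictly decreasing in `v`, so the reward rises up to the fixed point and
falls after it. -/
lemma deriv_expReward_eq (hF : RegularNoise F) (u v : ℝ) :
    1 - F (v - u) - v * deriv F (v - u) = deriv F (v - u) * (invHazard F (v - u) - v) := by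
  have := (hF.density_pos (v - u)).ne'
  unfold invHazard
  field_simp

lemma expReward_le_of_invHazard_eq (hF : RegularNoise F) {u v : ℝ}
    (hv : invHazard F (v - u) = v) (w : ℝ) : expReward F w u ≤ expReward F v u := by
  have hd : Differentiable ℝ fun v => expReward F v u :=
    fun v => (hF.hasDerivAt_expReward u v).differentiableAt
  rcases le_total w v with h | h
  · refine monotoneOn_of_deriv_nonneg (convex_Iic v) hd.continuous.continuousOn
      hd.differentiableOn (fun z hz => ?_) h (Set.mem_Iic.2 le_rfl) h
    rw [interior_Iic] at hz
    rw [(hF.hasDerivAt_expReward u z).deriv, hF.deriv_expReward_eq]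
    have : invHazard F (v - u) < invHazard F (z - u) :=
      hF.strictAnti_invHazard (sub_lt_sub_right hz u)
    exact mul_nonneg (hF.density_pos _).le (by linarith [Set.mem_Iio.1 hz])
  · refine antitoneOn_of_deriv_nonpos (convex_Ici v) hd.continuous.continuousOn
      hd.differentiableOn (fun z hz => ?_) (Set.mem_Ici.2 le_rfl) h h
    rw [interior_Ici] at hz
    rw [(hF.hasDerivAt_expReward u z).deriv, hF.deriv_expReward_eq]
    have : invHazard F (z - u) < invHazard F (v - u) :=
      hF.strictAnti_invHazard (sub_lt_sub_right hz u)
    exact mul_nonpos_of_nonneg_of_nonpos (hF.density_pos _).le (by linarith [Set.mem_Ioi.1 hz])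

lemma expReward_le_greedyPrice (hF : RegularNoise F) (u w : ℝ) :
    expReward F w u ≤ expReward F (greedyPrice F u) u := by
  obtain ⟨v, hv⟩ := hF.exists_invHazard_eq u
  exact Classical.epsilon_spec (p := fun v => ∀ w : ℝ, expReward F w u ≤ expReward F v u)
    ⟨v, hF.expReward_le_of_invHazard_eq hv⟩ w

lemma iSup_expReward (hF : RegularNoise F) (u : ℝ) :
    ⨆ v : ℝ, expReward F v u = expReward F (greedyPrice F u) u :=
  le_antisymm (ciSup_le (hF.expReward_le_greedyPrice u))
    (le_ciSup (f := fun v => expReward F v u)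
      ⟨_, Set.forall_mem_range.2 (hF.expReward_le_greedyPrice u)⟩ _)

lemma deriv_expReward_greedyPrice (hF : RegularNoise F) (u : ℝ) :
    1 - F (greedyPrice F u - u) - greedyPrice F u * deriv F (greedyPrice F u - u) = 0 :=
  IsLocalMax.hasDerivAt_eq_zero
    (Filter.Eventually.of_forall (hF.expReward_le_greedyPrice u)) (hF.hasDerivAt_expReward u _)

lemma invHazard_greedyPrice (hF : RegularNoise F) (u : ℝ) :
    invHazard F (greedyPrice F u - u) = greedyPrice F u := by
  have h := hF.deriv_expReward_greedyPrice u
  rw [hF.deriv_expReward_eq] at h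
  rcases mul_eq_zero.1 h with h | h
  · exact absurd h (hF.density_pos _).ne'
  · linarith

lemma greedyPrice_pos (hF : RegularNoise F) (u : ℝ) : 0 < greedyPrice F u := by
  rw [← hF.invHazard_greedyPrice u]
  exact hF.invHazard_pos _

/-- If `J(u) - u` increased, then so would `J(u)`; but `J(u)` is a decreasing function of `J(u) -
u`. With monotonicity of `J`, this makes `J` 1-Lipschitz. -/
lemma antitone_greedyPrice_sub (hF : RegularNoise F) : Antitone fun u => greedyPrice F u - u := by
  intro a b hab
  by_contra! h
  have := hF.strictAnti_invHazard h
  rw [hF.invHazard_greedyPrice, hF.invHazard_greedyPrice] at this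
  linarith

lemma monotone_greedyPrice (hF : RegularNoise F) : Monotone (greedyPrice F) := by
  intro a b hab
  have := hF.strictAnti_invHazard.antitone (hF.antitone_greedyPrice_sub hab)
  rwa [hF.invHazard_greedyPrice, hF.invHazard_greedyPrice] at this

lemma abs_greedyPrice_sub_le (hF : RegularNoise F) (a b : ℝ) :
    |greedyPrice F a - greedyPrice F b| ≤ |a - b| := by
  rcases le_total a b with h | h
  · rw [abs_sub_comm, abs_sub_comm a, abs_of_nonneg (sub_nonneg.2 h),
      abs_of_nonneg (sub_nonneg.2 (hF.monotone_greedyPrice h))]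
    have : greedyPrice F b - b ≤ greedyPrice F a - a := hF.antitone_greedyPrice_sub h
    linarith
  · rw [abs_of_nonneg (sub_nonneg.2 h),
      abs_of_nonneg (sub_nonneg.2 (hF.monotone_greedyPrice h))]
    have : greedyPrice F a - a ≤ greedyPrice F b - b := hF.antitone_greedyPrice_sub h
    linarith

/-- This is why `Cdown` and `Cexp` are taken over this interval: it contains price minus valuation
for both the estimated and the true valuation. -/
lemma greedyPrice_sub_mem (hF : RegularNoise F) {B u u' : ℝ} (hu : u ∈ Set.Icc 0 B)
    (hu' : u' ∈ Set.Icc 0 B) :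
    greedyPrice F u - u' ∈ Set.Icc (-B) (B + greedyPrice F 0) := by
  have h1 := hF.greedyPrice_pos u
  have h2 : greedyPrice F u - u ≤ greedyPrice F 0 - 0 := hF.antitone_greedyPrice_sub hu.1
  obtain ⟨_, _⟩ := hu
  obtain ⟨_, _⟩ := hu'
  constructor <;> linarith

/-- Pricing for a wrong expected valuation costs at most quadratically in the error. -/
lemma exists_reward_gap_le (hF : RegularNoise F) (B : ℝ) :
    ∃ C, 0 < C ∧ ∀ u ∈ Set.Icc 0 B, ∀ u' ∈ Set.Icc 0 B,
      (⨆ v : ℝ, expReward F v u') - expReward F (greedyPrice F u) u' ≤ C * (u - u') ^ 2 := by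
  obtain ⟨K, hK⟩ := hF.bddAbove_density
  obtain ⟨L, hL⟩ := hF.bddAbove_deriv_density
  have hK' : ∀ y, |deriv F y| ≤ K := fun y => hK ⟨y, rfl⟩
  have hL' : ∀ y, |deriv (deriv F) y| ≤ L := fun y => hL ⟨y, rfl⟩
  have hK0 : 0 < K := (abs_pos.2 (hF.density_pos 0).ne').trans_le (hK' 0)
  have hL0 : 0 ≤ L := (abs_nonneg _).trans (hL' 0)
  have hJB := hF.greedyPrice_pos B
  -- The constant bounds the second derivative of the reward, `-2 f - v f'`, for prices between `0`
  -- and `J(B)`. The mean value inequality is then used twice: for the derivative `φ`, which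
  -- vanishes at `a`, and for the reward.
  refine ⟨2 * K + greedyPrice F B * L, by positivity, fun u hu u' hu' => ?_⟩
  set M := 2 * K + greedyPrice F B * L with hM
  have hM0 : 0 ≤ M := by positivity
  rw [hF.iSup_expReward]
  set a := greedyPrice F u' with ha
  set b := greedyPrice F u with hb
  have hab : |b - a| ≤ |u - u'| := hF.abs_greedyPrice_sub_le u u'
  have hseg : ∀ z ∈ Set.uIcc a b, |z| ≤ greedyPrice F B ∧ |z - a| ≤ |b - a| := by
    intro z hz
    have h3 := hF.monotone_greedyPrice hu.2
    have h4 := hF.monotone_greedyPrice hu'.2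
    have h5 := hF.greedyPrice_pos u
    have h6 := hF.greedyPrice_pos u'
    refine ⟨?_, Set.abs_sub_left_of_mem_uIcc hz⟩
    have h7 := (Set.mem_uIcc.1 hz)
    rw [abs_le]
    constructor <;> rcases h7 with h7 | h7 <;> linarith [h7.1, h7.2]
  let φ : ℝ → ℝ := fun v => 1 - F (v - u') - v * deriv F (v - u')
  have hφ : ∀ v, HasDerivAt φ (-2 * deriv F (v - u') - v * deriv (deriv F) (v - u')) v := by
    intro v
    have h1 : HasDerivAt (fun v => F (v - u')) (deriv F (v - u')) v :=
      (hF.hasDerivAt (v - u')).comp_sub_const v u'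
    have h2 : HasDerivAt (fun v => deriv F (v - u')) (deriv (deriv F) (v - u')) v :=
      (hF.hasDerivAt_deriv (v - u')).comp_sub_const v u'
    have h3 := (h1.const_sub 1).sub ((hasDerivAt_id v).mul h2)
    convert! h3 using 1
    simp
    ring
  have hφa : φ a = 0 := hF.deriv_expReward_greedyPrice u'
  have hbound : ∀ z ∈ Set.uIcc a b, ‖φ z‖ ≤ M * |b - a| := by
    intro z hz
    have := (convex_uIcc a b).norm_image_sub_le_of_norm_hasDerivWithin_le (f := φ) (C := M)
      (fun y _ => (hφ y).hasDerivWithinAt) (fun y hy => ?_) Set.left_mem_uIcc hz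
    · rw [hφa, sub_zero] at this
      exact this.trans (mul_le_mul_of_nonneg_left (hseg z hz).2 hM0)
    · rw [Real.norm_eq_abs]
      calc |-2 * deriv F (y - u') - y * deriv (deriv F) (y - u')|
          ≤ |-2 * deriv F (y - u')| + |y * deriv (deriv F) (y - u')| := abs_sub _ _
        _ = 2 * |deriv F (y - u')| + |y| * |deriv (deriv F) (y - u')| := by
            rw [abs_mul, abs_mul]; norm_num
        _ ≤ M := add_le_add (mul_le_mul_of_nonneg_left (hK' _) (by norm_num))
            (mul_le_mul (hseg y hy).1 (hL' _) (abs_nonneg _) hJB.le)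
  have h8 := (convex_uIcc a b).norm_image_sub_le_of_norm_hasDerivWithin_le
      (f := fun v => expReward F v u') (C := M * |b - a|)
      (fun y _ => (hF.hasDerivAt_expReward u' y).hasDerivWithinAt) hbound
      Set.left_mem_uIcc Set.right_mem_uIcc
  rw [Real.norm_eq_abs, Real.norm_eq_abs, abs_sub_comm] at h8
  calc _ ≤ M * |b - a| * |b - a| := (le_abs_self _).trans h8
    _ = M * |b - a| ^ 2 := by ring
    _ ≤ M * |u - u'| ^ 2 := by gcongr
    _ = M * (u - u') ^ 2 := by rw [sq_abs]

/-! ### The constants `Cexp` and `Cdown`, and the information carried by the score. -/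

variable {B : ℝ}

lemma bddAbove_Cexp (hF : RegularNoise F) (B : ℝ) :
    BddAbove ((fun y => max (deriv F y ^ 2 / F y ^ 2) (deriv F y ^ 2 / (1 - F y) ^ 2)) ''
      Set.Icc (-B) (B + greedyPrice F 0)) := by
  refine (isCompact_Icc.image (Continuous.max ?_ ?_)).bddAbove
  · exact (hF.continuous_deriv.pow 2).div (hF.continuous.pow 2)
      fun y => (pow_pos (hF.pos y) 2).ne'
  · exact (hF.continuous_deriv.pow 2).div ((continuous_const.sub hF.continuous).pow 2)
      fun y => (pow_pos (hF.compl_pos y) 2).ne'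

lemma max_le_Cexp (hF : RegularNoise F) {y : ℝ} (hy : y ∈ Set.Icc (-B) (B + greedyPrice F 0)) :
    max (deriv F y ^ 2 / F y ^ 2) (deriv F y ^ 2 / (1 - F y) ^ 2) ≤ Cexp F B :=
  le_csSup (hF.bddAbove_Cexp B) ⟨y, hy, rfl⟩

lemma Cexp_pos (hF : RegularNoise F) (hB : 0 < B) : 0 < Cexp F B := by
  have h0 := hF.greedyPrice_pos 0
  refine lt_of_lt_of_le (lt_max_of_lt_left ?_)
    (hF.max_le_Cexp (B := B) (y := 0) ⟨by linarith, by linarith⟩)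
  exact div_pos (pow_pos (hF.density_pos 0) 2) (pow_pos (hF.pos 0) 2)

lemma le_deriv_of_Cdown_pos (hF : RegularNoise F) (h : 0 < Cdown F B) {y : ℝ}
    (hy : y ∈ Set.Icc (-B) (B + greedyPrice F 0)) :
    Cdown F B ≤ deriv (fun z => deriv F z / (1 - F z)) y ∧
      Cdown F B ≤ deriv (fun z => -(deriv F z / F z)) y := by
  -- `sInf` of a set that is not bounded below is `0`, so positivity of `Cdown` already gives
  -- boundedness.
  have hbdd : BddBelow ((fun y => min (-deriv (deriv (fun z => Real.log (1 - F z))) y)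
      (-deriv (deriv (fun z => Real.log (F z))) y)) '' Set.Icc (-B) (B + greedyPrice F 0)) := by
    by_contra hn
    rw [Cdown, Real.sInf_of_not_bddBelow hn] at h
    exact lt_irrefl _ h
  have := csInf_le hbdd ⟨y, hy, rfl⟩
  have h2 : Cdown F B ≤ _ ∧ Cdown F B ≤ _ := le_min_iff.1 this
  rw [hF.deriv_log, hF.deriv_log_compl, deriv.fun_neg, neg_neg] at h2
  rwa [deriv.fun_neg]

/-- Expected derivative of the log-loss at argument `w` when the true argument is `w'`. -/
lemma exists_score_lower_bound (hF : RegularNoise F) (hB : 0 < B) :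
    ∃ c, 0 < c ∧ (0 < Cdown F B → c = Cdown F B) ∧
      ∀ w ∈ Set.Icc (-B) (B + greedyPrice F 0), ∀ w' ∈ Set.Icc (-B) (B + greedyPrice F 0),
        c * (w' - w) ^ 2 ≤
          (F w' * (deriv F w / F w) - (1 - F w') * (deriv F w / (1 - F w))) * (w' - w) := by
  by_cases h : 0 < Cdown F B
  · refine ⟨_, h, fun _ => rfl, fun w hw w' hw' => ?_⟩
    have h1 := mul_sq_le_of_le_deriv hF.differentiable_hazard
      (fun y hy => (hF.le_deriv_of_Cdown_pos h hy).1) hw hw'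
    have h2 := mul_sq_le_of_le_deriv hF.differentiable_reversedHazard.neg
      (fun y hy => (hF.le_deriv_of_Cdown_pos h hy).2) hw hw'
    simp only [Pi.neg_apply] at h2
    have h3 := mul_le_mul_of_nonneg_left h1 (hF.compl_pos w').le
    have h4 := mul_le_mul_of_nonneg_left h2 (hF.pos w').le
    -- The expected score vanishes at the true argument `w'`: both of its halves equal `f(w')` and
    -- cancel.
    have h5 : (1 - F w') * (deriv F w' / (1 - F w')) = deriv F w' :=
      mul_div_cancel₀ _ (hF.compl_pos w').ne'
    have h6 : F w' * (deriv F w' / F w') = deriv F w' := mul_div_cancel₀ _ (hF.pos w').ne'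
    linear_combination h3 + h4 + (w' - w) * h5 - (w' - w) * h6
  -- Strict log-concavity allows second derivatives to vanish at points. The fallback uses that the
  -- expected score equals `f(w) (F(w') - F(w)) / (F(w) (1 - F(w)))`, with density at least its
  -- positive minimum `f(z)`.
  · have h0 := hF.greedyPrice_pos 0
    obtain ⟨z, hz, hmin⟩ := (isCompact_Icc (a := -B) (b := B + greedyPrice F 0)).exists_isMinOn
      ⟨0, by linarith, by linarith⟩ hF.continuous_deriv.continuousOn
    have hm := hF.density_pos z
    refine ⟨deriv F z ^ 2, pow_pos hm 2, fun h' => absurd h' h, fun w hw w' hw' => ?_⟩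
    have h1 : deriv F z * (w' - w) ^ 2 ≤ (F w' - F w) * (w' - w) :=
      mul_sq_le_of_le_deriv (fun y => (hF.hasDerivAt y).differentiableAt)
        (fun y hy => hmin hy) hw hw'
    have h2 : deriv F z ≤ deriv F w := hmin hw
    have h3 := hF.pos w
    have h4 := hF.compl_pos w
    have h5 : F w * (1 - F w) ≤ 1 := by nlinarith
    have h6 : 0 ≤ (F w' - F w) * (w' - w) :=
      (mul_nonneg hm.le (sq_nonneg _)).trans h1
    calc deriv F z ^ 2 * (w' - w) ^ 2 = deriv F z * (deriv F z * (w' - w) ^ 2) := by ring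
      _ ≤ deriv F w * ((F w' - F w) * (w' - w)) := mul_le_mul h2 h1 (by positivity) (by linarith)
      _ ≤ deriv F w * ((F w' - F w) * (w' - w)) / (F w * (1 - F w)) :=
          le_div_self (mul_nonneg (by linarith) h6) (by positivity) h5
      _ = _ := by field_simp; ring

end RegularNoise

end Pricing

end

/-! ### Determinant inequalities and the geometry of the Newton step. -/

noncomputable section

open Matrix in
lemma Matrix.PosDef.dotProduct_mulVec_comm {d : ℕ} {A : Matrix (Fin d) (Fin d) ℝ} (hA : A.PosDef)
    (y z : Fin d → ℝ) : y ⬝ᵥ A *ᵥ z = z ⬝ᵥ A *ᵥ y := by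
  have hT : Aᵀ = A := by simpa using hA.isHermitian.eq
  rw [dotProduct_mulVec, ← mulVec_transpose, hT, dotProduct_comm]

open Matrix in
lemma Matrix.PosDef.dotProduct_mulVec_self_nonneg {d : ℕ} {A : Matrix (Fin d) (Fin d) ℝ}
    (hA : A.PosDef) (y : Fin d → ℝ) : 0 ≤ y ⬝ᵥ A *ᵥ y := by
  simpa using hA.posSemidef.dotProduct_mulVec_nonneg y

open Matrix in
lemma Matrix.PosDef.add_vecMulVec {d : ℕ} {A : Matrix (Fin d) (Fin d) ℝ}
    (hA : A.PosDef) (g : Fin d → ℝ) : (A + vecMulVec g g).PosDef :=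
  hA.add_posSemidef (by simpa using posSemidef_vecMulVec_self_star g)

open Matrix in
/-- The elliptical potential inequality. -/
lemma Matrix.PosDef.dotProduct_inv_mulVec_le_log_det {d : ℕ} {A : Matrix (Fin d) (Fin d) ℝ}
    (hA : A.PosDef) (g : Fin d → ℝ) :
    g ⬝ᵥ (A + vecMulVec g g)⁻¹ *ᵥ g ≤
      Real.log (A + vecMulVec g g).det - Real.log A.det := by
  set A' := A + vecMulVec g g with hA'
  have hP : A'.PosDef := hA.add_vecMulVec g
  -- Matrix determinant lemma for `A = A' - g gᵀ`; the claim then follows from `log r ≤ r - 1`.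
  have hdet : A.det = A'.det * (1 - g ⬝ᵥ A'⁻¹ *ᵥ g) := by
    have h1 := det_add_replicateCol_mul_replicateRow (ι := Unit) hP.det_pos.ne'.isUnit (-g) g
    rw [← vecMulVec_eq, neg_vecMulVec, hA', add_neg_cancel_right, ← hA', det_unique (n := Unit)] at h1
    rw [h1]
    congr 1
    rw [Matrix.mul_assoc, ← replicateCol_mulVec, mulVec_neg]
    simp [Matrix.mul_apply, dotProduct, sub_eq_add_neg]
  have hq : 0 < 1 - g ⬝ᵥ A'⁻¹ *ᵥ g :=
    pos_of_mul_pos_right (hdet ▸ hA.det_pos) hP.det_pos.le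
  rw [hdet, Real.log_mul hP.det_pos.ne' hq.ne']
  linarith [Real.log_le_sub_one_of_pos hq]

/-- A determinant bound by the trace. -/
lemma Matrix.PosDef.log_det_le {d : ℕ} {A : Matrix (Fin d) (Fin d) ℝ}
    (hA : A.PosDef) {m : ℝ} (hm : 0 < m) (htr : A.trace ≤ d * m) :
    Real.log A.det ≤ d * Real.log m := by
  have hpos := hA.eigenvalues_pos
  rw [hA.isHermitian.det_eq_prod_eigenvalues]
  rw [hA.isHermitian.trace_eq_sum_eigenvalues] at htr
  simp only [RCLike.ofReal_real_eq_id, id_eq] at htr ⊢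
  rw [Real.log_prod fun i _ => (hpos i).ne']
  -- The tangent bound `log r ≤ r - 1` at `r = λᵢ / m`; the corrections sum to `tr A / m - d ≤ 0`.
  calc _ ≤ ∑ i, (Real.log m + (hA.isHermitian.eigenvalues i / m - 1)) := by
        refine Finset.sum_le_sum fun i _ => ?_
        have := Real.log_le_sub_one_of_pos (div_pos (hpos i) hm)
        rw [Real.log_div (hpos i).ne' hm.ne'] at this
        linarith
    _ = d * Real.log m + ((∑ i, hA.isHermitian.eigenvalues i) / m - d) := by
        simp [Finset.sum_add_distrib, Finset.sum_div]
    _ ≤ _ := by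
        have : (∑ i, hA.isHermitian.eigenvalues i) / m ≤ d := (div_le_iff₀ hm).2 htr
        linarith

namespace Pricing

open Matrix

variable {d : ℕ} {H : Set (Vec d)} {A : Matrix (Fin d) (Fin d) ℝ}

lemma continuous_sqDist (A : Matrix (Fin d) (Fin d) ℝ) (z : Vec d) :
    Continuous fun y => sqDist A y z := by
  have h : Continuous fun y : Vec d => (y - z).ofLp :=
    (PiLp.continuous_ofLp 2 _).comp (continuous_id.sub continuous_const)
  exact h.dotProduct (continuous_const.matrix_mulVec h)

lemma proj_spec (hH : IsCompact H) (hne : H.Nonempty) (A : Matrix (Fin d) (Fin d) ℝ) (z : Vec d) :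
    proj H A z ∈ H ∧ ∀ y ∈ H, sqDist A (proj H A z) z ≤ sqDist A y z :=
  Classical.epsilon_spec (p := fun y => y ∈ H ∧ ∀ y' ∈ H, sqDist A y z ≤ sqDist A y' z)
    (hH.exists_isMinOn hne (continuous_sqDist A z).continuousOn)

/-- The projection does not increase the distance to points of the convex set. -/
lemma sqDist_proj_le (hA : A.PosDef) (hH : IsCompact H) (hconv : Convex ℝ H) {y : Vec d}
    (hy : y ∈ H) (z : Vec d) : sqDist A (proj H A z) y ≤ sqDist A z y := by
  obtain ⟨hp, hmin⟩ := proj_spec hH ⟨y, hy⟩ A z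
  set p := proj H A z
  let b : ℝ := (p - z).ofLp ⬝ᵥ A *ᵥ (y - p).ofLp
  have hsymm : (y - p).ofLp ⬝ᵥ A *ᵥ (p - z).ofLp = b := hA.dotProduct_mulVec_comm _ _
  have hexp : ∀ t : ℝ, sqDist A (p + t • (y - p)) z
      = sqDist A p z + 2 * t * b + t ^ 2 * sqDist A y p := by
    intro t
    have h1 : p + t • (y - p) - z = (p - z) + t • (y - p) := by abel
    unfold sqDist
    rw [h1, WithLp.ofLp_add, WithLp.ofLp_smul]
    simp only [mulVec_add, mulVec_smul, add_dotProduct, dotProduct_add, smul_dotProduct,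
      dotProduct_smul, smul_eq_mul, hsymm]
    ring
  -- First-order optimality: compare `p` with `p + t (y - p)`, divide by `t` and let `t` tend to
  -- `0`.
  have hb : 0 ≤ b := by
    have hlim : ∀ t ∈ Set.Ioc (0 : ℝ) 1, 0 ≤ 2 * b + t * sqDist A y p := by
      intro t ht
      have hmem : p + t • (y - p) ∈ H := hconv.add_smul_sub_mem hp hy ⟨ht.1.le, ht.2⟩
      have h1 := hmin _ hmem
      rw [hexp t] at h1
      exact nonneg_of_mul_nonneg_right (by linarith) ht.1
    have hc : Continuous fun t : ℝ => 2 * b + t * sqDist A y p := by fun_prop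
    have h0 := ge_of_tendsto (hc.continuousWithinAt (s := Set.Ioi 0) (x := 0)).tendsto
      (Filter.mem_of_superset (Ioc_mem_nhdsGT one_pos) hlim)
    linarith
  have hexp1 := hexp 1
  have h2 : sqDist A z y = sqDist A (p + (1 : ℝ) • (y - p)) z := by
    have h3 : z - y = -(p + (1 : ℝ) • (y - p) - z) := by
      rw [one_smul]; abel
    unfold sqDist
    rw [h3, WithLp.ofLp_neg, mulVec_neg, neg_dotProduct_neg]
  have h4 : sqDist A p y = sqDist A y p := by
    unfold sqDist
    rw [← neg_sub, WithLp.ofLp_neg, mulVec_neg, neg_dotProduct_neg]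
  have h5 : 0 ≤ sqDist A p z := hA.dotProduct_mulVec_self_nonneg _
  rw [h2, h4, hexp1]
  linarith

/-- Lyapunov function of the Online Newton Step relative to the comparator `θ`. -/
def onsPotential (γ : ℝ) (θ : Vec d) (s : Vec d × Matrix (Fin d) (Fin d) ℝ) : ℝ :=
  γ * sqDist s.2 s.1 θ - (1 / γ) * Real.log s.2.det

/-- Expand the square: the rank-one part of the new matrix gives `γ⟨g, y - z⟩²`, and the cross term
simplifies because the new matrix cancels its inverse. -/
lemma sqDist_newton_step (hA : A.PosDef) {γ : ℝ} (hγ : 0 < γ) (y z g : Vec d) :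
    γ * sqDist (A + vecMulVec g.ofLp g.ofLp)
        (y - (1 / γ) • WithLp.toLp 2 ((A + vecMulVec g.ofLp g.ofLp)⁻¹.mulVec g.ofLp)) z
      = γ * sqDist A y z + γ * inner ℝ g (y - z) ^ 2 - 2 * inner ℝ g (y - z)
        + (1 / γ) * (g.ofLp ⬝ᵥ (A + vecMulVec g.ofLp g.ofLp)⁻¹ *ᵥ g.ofLp) := by
  set A' := A + vecMulVec g.ofLp g.ofLp with hA'
  have hP : A'.PosDef := hA.add_vecMulVec g.ofLp
  set q := A'⁻¹ *ᵥ g.ofLp with hq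
  set δ := (y - z).ofLp with hδ
  have hAq : A' *ᵥ q = g.ofLp := by
    rw [hq, mulVec_mulVec, mul_nonsing_inv _ hP.det_pos.ne'.isUnit, one_mulVec]
  have hinner : inner ℝ g (y - z) = g.ofLp ⬝ᵥ δ := by
    rw [EuclideanSpace.inner_eq_star_dotProduct, dotProduct_comm]
    simp [hδ]
  have h1 : q ⬝ᵥ A' *ᵥ δ = g.ofLp ⬝ᵥ δ := by
    rw [hP.dotProduct_mulVec_comm, hAq, dotProduct_comm]
  have h2 : δ ⬝ᵥ A' *ᵥ δ = δ ⬝ᵥ A *ᵥ δ + (g.ofLp ⬝ᵥ δ) ^ 2 := by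
    rw [hA', add_mulVec, dotProduct_add, vecMulVec_mulVec]
    simp only [op_smul_eq_smul, dotProduct_smul, smul_eq_mul, dotProduct_comm δ g.ofLp]
    ring
  have h3 : (y - (1 / γ) • WithLp.toLp 2 q - z).ofLp = δ - (1 / γ) • q := by
    rw [sub_right_comm, hδ]
    rfl
  rw [hinner]
  unfold sqDist
  rw [h3, ← hδ]
  simp only [mulVec_sub, mulVec_smul, sub_dotProduct, dotProduct_sub, smul_dotProduct,
    dotProduct_smul, smul_eq_mul, h1, h2, hAq, dotProduct_comm δ g.ofLp, dotProduct_comm q g.ofLp]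
  field_simp
  ring

lemma onsUpdate_posDef {F : ℝ → ℝ} {γ : ℝ} {s : Vec d × Matrix (Fin d) (Fin d) ℝ}
    (hs : s.2.PosDef) (x : Vec d) (v : ℝ) (b : Bool) : (onsUpdate F H γ s x v b).2.PosDef :=
  hs.add_vecMulVec _

lemma onsUpdate_mem {F : ℝ → ℝ} {γ : ℝ} {s : Vec d × Matrix (Fin d) (Fin d) ℝ}
    (hH : IsCompact H) (hs : s.1 ∈ H) (x : Vec d) (v : ℝ) (b : Bool) :
    (onsUpdate F H γ s x v b).1 ∈ H :=
  (proj_spec hH ⟨_, hs⟩ _ _).1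

lemma trace_onsUpdate {F : ℝ → ℝ} {γ : ℝ} (s : Vec d × Matrix (Fin d) (Fin d) ℝ)
    (x : Vec d) (v : ℝ) (b : Bool) :
    (onsUpdate F H γ s x v b).2.trace = s.2.trace + ‖gradient (negLogLik F x v b) s.1‖ ^ 2 := by
  simp only [onsUpdate, trace_add, trace_vecMulVec, EuclideanSpace.real_norm_sq_eq, dotProduct,
    ← sq]

/-- The projection only shortens the distance to `θ`, and the growth of `log det` pays for the term
`(1/γ) gᵀ A⁻¹ g` of the Newton step. -/
lemma onsPotential_step {F : ℝ → ℝ} {γ : ℝ} (hγ : 0 < γ) (hH : IsCompact H) (hconv : Convex ℝ H)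
    {θ : Vec d} (hθ : θ ∈ H) {s : Vec d × Matrix (Fin d) (Fin d) ℝ} (hs : s.2.PosDef)
    (x : Vec d) (v : ℝ) (b : Bool) :
    2 * inner ℝ (gradient (negLogLik F x v b) s.1) (s.1 - θ)
        - γ * inner ℝ (gradient (negLogLik F x v b) s.1) (s.1 - θ) ^ 2
      ≤ onsPotential γ θ s - onsPotential γ θ (onsUpdate F H γ s x v b) := by
  set g := gradient (negLogLik F x v b) s.1 with hg
  have h1 := sqDist_newton_step hs hγ s.1 θ g
  have h2 := mul_le_mul_of_nonneg_left (hs.dotProduct_inv_mulVec_le_log_det g.ofLp)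
    (one_div_pos.2 hγ).le
  have h3 := mul_le_mul_of_nonneg_left
    (sqDist_proj_le (hs.add_vecMulVec g.ofLp) hH hconv hθ
      (s.1 - (1 / γ) • WithLp.toLp 2 ((s.2 + vecMulVec g.ofLp g.ofLp)⁻¹.mulVec g.ofLp))) hγ.le
  simp only [onsPotential, onsUpdate, ← hg]
  linarith

end Pricing

end

/-! ### Conditioning on the transcript. -/

noncomputable section

namespace Pricing

open MeasureTheory ProbabilityTheory

section FiniteRange

variable {Ω τ : Type*} {X : Ω → τ}

/-- Each round adds one bit, so a transcript has finitely many values. Integrals become finite sums,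
and no measurability of the policy, whose maximizers and projections are arbitrary choices, is
required. -/
lemma eq_sum_indicator_of_finite_range (hX : (Set.range X).Finite) (G : τ → Ω → ℝ) :
    (fun ω => G (X ω) ω) =
      fun ω => ∑ h ∈ hX.toFinset, (X ⁻¹' {h}).indicator (G h) ω := by
  classical
  funext ω
  rw [Finset.sum_eq_single (X ω)]
  · simp
  · intro h _ hne
    exact Set.indicator_of_notMem (fun hm => hne hm.symm) _
  · intro hn
    simp at hn

variable [MeasurableSpace Ω] {P : Measure Ω}

lemma integrable_of_finite_range (hX : (Set.range X).Finite)
    (hXm : ∀ h, MeasurableSet (X ⁻¹' {h})) {G : τ → Ω → ℝ} (hG : ∀ h, Integrable (G h) P) :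
    Integrable (fun ω => G (X ω) ω) P := by
  rw [eq_sum_indicator_of_finite_range hX]
  exact integrable_finsetSum _ fun h _ => (hG h).indicator (hXm h)

lemma integral_of_finite_range (hX : (Set.range X).Finite)
    (hXm : ∀ h, MeasurableSet (X ⁻¹' {h})) {G : τ → Ω → ℝ} (hG : ∀ h, Integrable (G h) P) :
    ∫ ω, G (X ω) ω ∂P = ∑ h ∈ hX.toFinset, ∫ ω in X ⁻¹' {h}, G h ω ∂P := by
  rw [eq_sum_indicator_of_finite_range hX,
    integral_finsetSum _ fun h _ => (hG h).indicator (hXm h)]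
  exact Finset.sum_congr rfl fun h _ => integral_indicator (hXm h)

open Classical in
/-- Averaging out an event that is independent of a finitely valued variable. -/
lemma integral_ite_of_indep [IsProbabilityMeasure P] (hX : (Set.range X).Finite)
    (hXm : ∀ h, MeasurableSet (X ⁻¹' {h})) {E : τ → Set Ω} (hE : ∀ h, MeasurableSet (E h))
    (hind : ∀ h, P.real (X ⁻¹' {h} ∩ E h) = P.real (X ⁻¹' {h}) * P.real (E h)) (a b : τ → ℝ) :
    ∫ ω, (if ω ∈ E (X ω) then a (X ω) else b (X ω)) ∂P =
      ∫ ω, (P.real (E (X ω)) * a (X ω) + (1 - P.real (E (X ω))) * b (X ω)) ∂P := by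
  have hite : ∀ h, (fun ω => if ω ∈ E h then a h else b h) =
      fun ω => (E h).indicator (fun _ => a h - b h) ω + b h := by
    intro h
    funext ω
    by_cases hω : ω ∈ E h <;> simp [hω]
  have hint : ∀ h, Integrable ((E h).indicator fun _ => a h - b h) P := fun h =>
    (integrable_const _).indicator (hE h)
  rw [integral_of_finite_range hX hXm (G := fun h ω => if ω ∈ E h then a h else b h)
      (fun h => by rw [hite h]; exact (hint h).add (integrable_const _)),
    integral_of_finite_range hX hXm
      (G := fun h _ => P.real (E h) * a h + (1 - P.real (E h)) * b h)
      (fun h => integrable_const _)]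
  refine Finset.sum_congr rfl fun h _ => ?_
  rw [hite h, integral_add (hint h).integrableOn (integrable_const _).integrableOn,
    setIntegral_indicator (hE h), setIntegral_const, setIntegral_const, setIntegral_const,
    hind h]
  simp only [smul_eq_mul]
  ring

end FiniteRange

section Hist

variable {d : ℕ} (𝒜 : Policy d) (x : ℕ → Vec d) (θ : Vec d)

lemma hist_congr {n n' : ℕ → ℝ} {t : ℕ} (h : ∀ i < t, n i = n' i) :
    hist 𝒜 x θ n t = hist 𝒜 x θ n' t := by
  induction t with
  | zero => rfl
  | succ t ih =>
    simp only [hist, ih fun i hi => h i (hi.trans t.lt_succ_self), h t t.lt_succ_self]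

lemma finite_range_hist (t : ℕ) : (Set.range fun n : ℕ → ℝ => hist 𝒜 x θ n t).Finite := by
  induction t with
  | zero => exact (Set.finite_singleton []).subset (by rintro _ ⟨n, rfl⟩; rfl)
  | succ t ih =>
    refine ((ih.prod (Set.finite_univ (α := Bool))).image
      fun p => (x t, 𝒜 (x t) p.1, p.2) :: p.1).subset ?_
    rintro _ ⟨n, rfl⟩
    exact ⟨(hist 𝒜 x θ n t, _), ⟨⟨n, rfl⟩, Set.mem_univ _⟩, rfl⟩

lemma measurableSet_hist_eq (t : ℕ) (h : Transcript d) :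
    MeasurableSet {n : ℕ → ℝ | hist 𝒜 x θ n t = h} := by
  induction t generalizing h with
  | zero => exact MeasurableSet.const (α := ℕ → ℝ) ([] = h)
  | succ t ih =>
    cases h with
    | nil => simp [hist]
    | cons a h =>
      obtain ⟨y, v, b⟩ := a
      have hset : {n : ℕ → ℝ | hist 𝒜 x θ n (t + 1) = (y, v, b) :: h} =
          {n | hist 𝒜 x θ n t = h} ∩ ({n | x t = y} ∩ ({n | 𝒜 (x t) h = v} ∩
            {n | decide (𝒜 (x t) h ≤ inner ℝ (x t) θ + n t) = b})) := by
        ext n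
        simp only [hist, List.cons.injEq, Prod.mk.injEq, Set.mem_ofPred_eq, Set.mem_inter_iff]
        constructor
        · rintro ⟨⟨h1, h2, h3⟩, rfl⟩
          exact ⟨rfl, h1, h2, h3⟩
        · rintro ⟨rfl, h1, h2, h3⟩
          exact ⟨⟨h1, h2, h3⟩, rfl⟩
      have hm : MeasurableSet {n : ℕ → ℝ | 𝒜 (x t) h ≤ inner ℝ (x t) θ + n t} :=
        measurableSet_le measurable_const (measurable_const.add (measurable_pi_apply t))
      rw [hset]
      refine (ih h).inter ((MeasurableSet.const _).inter ((MeasurableSet.const _).inter ?_))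
      cases b
      · simp only [decide_eq_false_iff_not]
        exact hm.compl
      · simpa only [decide_eq_true_eq] using hm

variable {Ω : Type*} {N : ℕ → Ω → ℝ}

lemma finite_range_hist_noise (t : ℕ) :
    (Set.range fun ω => hist 𝒜 x θ (fun i => N i ω) t).Finite :=
  (finite_range_hist 𝒜 x θ t).subset (by rintro _ ⟨ω, rfl⟩; exact ⟨_, rfl⟩)

variable [MeasurableSpace Ω] {P : Measure Ω}

lemma measurableSet_hist_preimage (hN : ∀ t, Measurable (N t)) (t : ℕ) (h : Transcript d) :
    MeasurableSet ((fun ω => hist 𝒜 x θ (fun i => N i ω) t) ⁻¹' {h}) :=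
  (measurable_pi_lambda _ hN) (measurableSet_hist_eq 𝒜 x θ t h)

lemma integrable_hist [IsProbabilityMeasure P] (hN : ∀ t, Measurable (N t)) (Φ : Transcript d → ℝ) (t : ℕ) :
    Integrable (fun ω => Φ (hist 𝒜 x θ (fun i => N i ω) t)) P :=
  integrable_of_finite_range (finite_range_hist_noise 𝒜 x θ t)
    (measurableSet_hist_preimage 𝒜 x θ hN t) (G := fun h _ => Φ h) fun _ => integrable_const _

lemma measureReal_hist_inter (hN : ∀ t, Measurable (N t)) (hind : iIndepFun N P) (t : ℕ)
    (h : Transcript d) {s : Set ℝ} (hs : MeasurableSet s) :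
    P.real ((fun ω => hist 𝒜 x θ (fun i => N i ω) t) ⁻¹' {h} ∩ N t ⁻¹' s) =
      P.real ((fun ω => hist 𝒜 x θ (fun i => N i ω) t) ⁻¹' {h}) * P.real (N t ⁻¹' s) := by
  have hI := hind.indepFun_finset (Finset.range t) {t} (by simp) hN
  -- Padding by `0` is harmless, since the first `t` rounds see only the first `t` noises; the
  -- transcript is thus a function of variables independent of `N t`.
  let ext : (Finset.range t → ℝ) → ℕ → ℝ := fun y i =>
    if hi : i ∈ Finset.range t then y ⟨i, hi⟩ else 0
  have hext : Measurable ext := by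
    refine measurable_pi_lambda _ fun i => ?_
    by_cases hi : i ∈ Finset.range t
    · simpa only [ext, hi, dite_true] using measurable_pi_apply _
    · simpa only [ext, hi, dite_false] using measurable_const
  have h1 := hI.measure_inter_preimage_eq_mul _
    {y | y ⟨t, Finset.mem_singleton_self t⟩ ∈ s} (hext (measurableSet_hist_eq 𝒜 x θ t h))
    (measurable_pi_apply _ hs)
  have h2 : (fun ω (i : Finset.range t) => N i ω) ⁻¹'
      (ext ⁻¹' {n : ℕ → ℝ | hist 𝒜 x θ n t = h}) =
      (fun ω => hist 𝒜 x θ (fun i => N i ω) t) ⁻¹' {h} := by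
    ext ω
    have : hist 𝒜 x θ (ext fun i : Finset.range t => N i ω) t =
        hist 𝒜 x θ (fun i => N i ω) t :=
      hist_congr 𝒜 x θ fun i hi => by simp [ext, hi]
    simp [this]
  rw [h2] at h1
  simp only [measureReal_def, ← ENNReal.toReal_mul]
  exact congrArg ENNReal.toReal h1

/-- A sale is a non-strict inequality, so its probability involves the left limit of the CDF;
continuity removes the difference. -/
lemma measureReal_Ici_of_continuous {μ : Measure ℝ} [IsProbabilityMeasure μ] {F : ℝ → ℝ}
    (hcdf : ∀ y, F y = cdf μ y) (hF : Continuous F) (w : ℝ) : μ.real (Set.Ici w) = 1 - F w := by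
  have hF' : F = cdf μ := funext hcdf
  have h1 := (cdf μ).measure_Ici (tendsto_cdf_atTop μ) w
  rw [measure_cdf, ContinuousWithinAt.leftLim_eq (by
    rw [← hF']; exact hF.continuousWithinAt), ← hcdf] at h1
  rw [measureReal_def, h1, ENNReal.toReal_ofReal]
  rw [hcdf]
  linarith [cdf_le_one μ w]

/-- One-step conditioning on the transcript. -/
lemma integral_hist_succ [IsProbabilityMeasure P] {μ : Measure ℝ} [IsProbabilityMeasure μ] {F : ℝ → ℝ}
    (hcdf : ∀ y, F y = cdf μ y) (hF : Continuous F) (hN : ∀ t, Measurable (N t))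
    (hind : iIndepFun N P) (hμ : ∀ t, P.map (N t) = μ) (Φ : Transcript d → ℝ) (t : ℕ) :
    ∫ ω, Φ (hist 𝒜 x θ (fun i => N i ω) (t + 1)) ∂P =
      ∫ ω, (fun h => (1 - F (𝒜 (x t) h - inner ℝ (x t) θ)) * Φ ((x t, 𝒜 (x t) h, true) :: h)
        + F (𝒜 (x t) h - inner ℝ (x t) θ) * Φ ((x t, 𝒜 (x t) h, false) :: h))
        (hist 𝒜 x θ (fun i => N i ω) t) ∂P := by
  classical
  let E : Transcript d → Set Ω := fun h => N t ⁻¹' Set.Ici (𝒜 (x t) h - inner ℝ (x t) θ)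
  have hE : ∀ h, P.real (E h) = 1 - F (𝒜 (x t) h - inner ℝ (x t) θ) := by
    intro h
    rw [← measureReal_Ici_of_continuous hcdf hF, ← hμ t,
      map_measureReal_apply (hN t) measurableSet_Ici]
  have key := integral_ite_of_indep (P := P) (finite_range_hist_noise 𝒜 x θ (N := N) t)
    (measurableSet_hist_preimage 𝒜 x θ hN t) (E := E) (fun h => hN t measurableSet_Ici)
    (fun h => measureReal_hist_inter 𝒜 x θ hN hind t h measurableSet_Ici)
    (fun h => Φ ((x t, 𝒜 (x t) h, true) :: h)) (fun h => Φ ((x t, 𝒜 (x t) h, false) :: h))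
  simp only [hE, sub_sub_cancel] at key
  rw [← key]
  refine integral_congr_ae (Filter.Eventually.of_forall fun ω => ?_)
  simp only [hist, E, Set.mem_preimage, Set.mem_Ici, sub_le_iff_le_add']
  split_ifs with h <;> simp [h]

end Hist

end Pricing

end

/-! ### Expected potential drop and the regret bound. -/

noncomputable section

namespace Pricing

open MeasureTheory ProbabilityTheory

/-- Derivative in the expected valuation of the negative log-likelihood, at price minus expected
valuation `w` and sale indicator `b`. -/
def score (F : ℝ → ℝ) (b : Bool) (w : ℝ) : ℝ :=
  if b then -(deriv F w / (1 - F w)) else deriv F w / F w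

namespace RegularNoise

variable {F : ℝ → ℝ} {B : ℝ} {d : ℕ}

lemma gradient_negLogLik (hF : RegularNoise F) (x : Vec d) (v : ℝ) (b : Bool) (θ : Vec d) :
    gradient (negLogLik F x v b) θ = score F b (v - inner ℝ x θ) • x := by
  refine HasGradientAt.gradient (hasGradientAt_iff_hasFDerivAt.2 ?_)
  have hin : HasFDerivAt (fun θ : Vec d => v - inner ℝ x θ) (-(innerSL ℝ x)) θ :=
    (innerSL ℝ x).hasFDerivAt.const_sub v
  cases b
  · have := ((hF.hasDerivAt_log (v - inner ℝ x θ)).neg).comp_hasFDerivAt θ hin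
    convert! this using 1
    ext y
    simp [score]
  · have := ((hF.hasDerivAt_log_compl (v - inner ℝ x θ)).neg).comp_hasFDerivAt θ hin
    convert! this using 1
    ext y
    simp [score]

lemma score_sq_le (hF : RegularNoise F) {w : ℝ}
    (hw : w ∈ Set.Icc (-B) (B + greedyPrice F 0)) (b : Bool) : score F b w ^ 2 ≤ Cexp F B := by
  have h := max_le_iff.1 (hF.max_le_Cexp hw)
  cases b
  · simpa [score, div_pow] using h.1
  · simpa [score, div_pow] using h.2

/-- In expectation over the sale, the squared error of the estimated valuation is paid for by
the decrease of the potential. -/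
lemma sq_error_le_potential_drop (hF : RegularNoise F) {c γ : ℝ}
    (hc : ∀ w ∈ Set.Icc (-B) (B + greedyPrice F 0), ∀ w' ∈ Set.Icc (-B) (B + greedyPrice F 0),
      c * (w' - w) ^ 2 ≤
        (F w' * (deriv F w / F w) - (1 - F w') * (deriv F w / (1 - F w))) * (w' - w))
    (hγ : 0 < γ) (hγc : γ * Cexp F B ≤ c) {H : Set (Vec d)} (hH : IsCompact H)
    (hconv : Convex ℝ H) {θ : Vec d} (hθ : θ ∈ H) {s : Vec d × Matrix (Fin d) (Fin d) ℝ}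
    (hs : s.1 ∈ H) (hA : s.2.PosDef) {x : Vec d}
    (hx : ∀ θ ∈ H, 0 ≤ inner ℝ x θ ∧ inner ℝ x θ ≤ B) {v : ℝ}
    (hv : v = greedyPrice F (inner ℝ x s.1)) :
    c * (inner ℝ x s.1 - inner ℝ x θ) ^ 2 ≤ onsPotential γ θ s
      - ((1 - F (v - inner ℝ x θ)) * onsPotential γ θ (onsUpdate F H γ s x v true)
        + F (v - inner ℝ x θ) * onsPotential γ θ (onsUpdate F H γ s x v false)) := by
  subst hv
  set u := inner ℝ x s.1 with hu
  set u' := inner ℝ x θ with hu'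
  set v := greedyPrice F u
  have hw := hF.greedyPrice_sub_mem (hx _ hs) (hx _ hs)
  have hw' := hF.greedyPrice_sub_mem (hx _ hs) (hx _ hθ)
  have hstep : ∀ b, 2 * (score F b (v - u) * (u - u')) - c * (u - u') ^ 2 ≤
      onsPotential γ θ s - onsPotential γ θ (onsUpdate F H γ s x v b) := by
    intro b
    have h1 := onsPotential_step (F := F) hγ hH hconv hθ hA x v b
    rw [hF.gradient_negLogLik, real_inner_smul_left, inner_sub_right, ← hu, ← hu'] at h1
    -- The quadratic loss of the Newton step is bounded for either sale outcome; only the linear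
    -- term has to be averaged.
    have h2 : γ * (score F b (v - u) * (u - u')) ^ 2 ≤ c * (u - u') ^ 2 := by
      calc _ = γ * score F b (v - u) ^ 2 * (u - u') ^ 2 := by ring
        _ ≤ _ := mul_le_mul_of_nonneg_right
          ((mul_le_mul_of_nonneg_left (hF.score_sq_le hw b) hγ.le).trans hγc) (sq_nonneg _)
    linarith
  have h3 := mul_le_mul_of_nonneg_left (hstep true) (hF.compl_pos (v - u')).le
  have h4 := mul_le_mul_of_nonneg_left (hstep false) (hF.pos (v - u')).le
  have h5 := hc _ hw _ hw'
  simp only [score, Bool.false_eq_true, if_true, if_false] at h3 h4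
  linear_combination h3 + h4 + 2 * h5

end RegularNoise

section Invariants

variable {F : ℝ → ℝ} {d : ℕ} {H : Set (Vec d)} {θ₁ : Vec d} {γ ε : ℝ} {x : ℕ → Vec d}

lemma onsState_hist_succ (𝒜 : Policy d) (θ : Vec d) (n : ℕ → ℝ) (t : ℕ) :
    ∃ b, onsState F H θ₁ γ ε (hist 𝒜 x θ n (t + 1)) =
      onsUpdate F H γ (onsState F H θ₁ γ ε (hist 𝒜 x θ n t)) (x t)
        (𝒜 (x t) (hist 𝒜 x θ n t)) b :=
  ⟨_, rfl⟩

lemma onsState_hist_mem (hH : IsCompact H) (hθ₁ : θ₁ ∈ H) (𝒜 : Policy d) (θ : Vec d)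
    (n : ℕ → ℝ) (t : ℕ) : (onsState F H θ₁ γ ε (hist 𝒜 x θ n t)).1 ∈ H := by
  induction t with
  | zero => exact hθ₁
  | succ t ih =>
    obtain ⟨b, hb⟩ := onsState_hist_succ (F := F) (H := H) (θ₁ := θ₁) (γ := γ) (ε := ε) (x := x)
      𝒜 θ n t
    rw [hb]
    exact onsUpdate_mem hH ih _ _ _

lemma onsState_hist_posDef (hε : 0 < ε) (𝒜 : Policy d) (θ : Vec d)
    (n : ℕ → ℝ) (t : ℕ) : (onsState F H θ₁ γ ε (hist 𝒜 x θ n t)).2.PosDef := by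
  induction t with
  | zero => exact Matrix.PosDef.one.smul hε
  | succ t ih =>
    obtain ⟨b, hb⟩ := onsState_hist_succ (F := F) (H := H) (θ₁ := θ₁) (γ := γ) (ε := ε) (x := x)
      𝒜 θ n t
    rw [hb]
    exact onsUpdate_posDef ih _ _ _

lemma trace_onsState_hist_le {B B₂ : ℝ} (hF : RegularNoise F) (hH : IsCompact H) (hθ₁ : θ₁ ∈ H)
    (hxn : ∀ t, ‖x t‖ ≤ B₂) (hx : ∀ t, ∀ θ ∈ H, 0 ≤ inner ℝ (x t) θ ∧ inner ℝ (x t) θ ≤ B)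
    (θ : Vec d) (n : ℕ → ℝ) (t : ℕ) :
    (onsState F H θ₁ γ ε (hist (onsp F H θ₁ γ ε) x θ n t)).2.trace ≤
      d * ε + t * (Cexp F B * B₂ ^ 2) := by
  induction t with
  | zero => simp [hist, onsState, mul_comm]
  | succ t ih =>
    have hmem := onsState_hist_mem (F := F) (γ := γ) (ε := ε) (x := x) hH hθ₁
      (onsp F H θ₁ γ ε) θ n t
    obtain ⟨b, hb⟩ := onsState_hist_succ (F := F) (H := H) (θ₁ := θ₁) (γ := γ) (ε := ε) (x := x)
      (onsp F H θ₁ γ ε) θ n t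
    rw [hb, trace_onsUpdate, hF.gradient_negLogLik, norm_smul, mul_pow, Real.norm_eq_abs, sq_abs]
    have hw := hF.greedyPrice_sub_mem (hx t _ hmem) (hx t _ hmem)
    have h1 := mul_le_mul (hF.score_sq_le hw b) (pow_le_pow_left₀ (norm_nonneg _) (hxn t) 2)
      (sq_nonneg _) ((sq_nonneg _).trans (hF.score_sq_le hw b))
    push_cast
    unfold onsp at h1 ih ⊢
    linarith

lemma neg_onsPotential_hist_le {B B₂ : ℝ} (hF : RegularNoise F) (hd : 0 < d) (hγ : 0 < γ)
    (hε : 0 < ε) (hH : IsCompact H) (hθ₁ : θ₁ ∈ H)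
    (hxn : ∀ t, ‖x t‖ ≤ B₂) (hx : ∀ t, ∀ θ ∈ H, 0 ≤ inner ℝ (x t) θ ∧ inner ℝ (x t) θ ≤ B)
    (hC : 0 ≤ Cexp F B) (θ : Vec d) (n : ℕ → ℝ) (t : ℕ) :
    -onsPotential γ θ (onsState F H θ₁ γ ε (hist (onsp F H θ₁ γ ε) x θ n t)) ≤
      1 / γ * (d * Real.log (ε + t * (Cexp F B * B₂ ^ 2))) := by
  have hA := onsState_hist_posDef (F := F) (H := H) (θ₁ := θ₁) (γ := γ) (x := x) hε
    (onsp F H θ₁ γ ε) θ n t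
  have htr := trace_onsState_hist_le (γ := γ) (ε := ε) hF hH hθ₁ hxn hx θ n t
  have hS : 0 ≤ t * (Cexp F B * B₂ ^ 2) := by positivity
  have hd1 : (1 : ℝ) ≤ d := by exact_mod_cast hd
  -- The trace is at most `d ε + S ≤ d (ε + S)`, where `S` is the sum of the squared gradient
  -- bounds; this uses `1 ≤ d`.
  have hdet := hA.log_det_le (m := ε + t * (Cexp F B * B₂ ^ 2)) (by linarith)
    (htr.trans (by nlinarith))
  have h0 := mul_nonneg hγ.le (hA.dotProduct_mulVec_self_nonneg
    ((onsState F H θ₁ γ ε (hist (onsp F H θ₁ γ ε) x θ n t)).1 - θ).ofLp)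
  have h1 := mul_le_mul_of_nonneg_left hdet (one_div_pos.2 hγ).le
  unfold onsPotential sqDist
  linarith

lemma onsPotential_init {B₁ : ℝ} (hγ : 0 < γ) (hε : 0 < ε) {θ : Vec d} (hθ : ‖θ‖ ≤ B₁)
    (hθ₁ : ‖θ₁‖ ≤ B₁) :
    onsPotential γ θ (onsState F H θ₁ γ ε []) ≤
      γ * (ε * (2 * B₁) ^ 2) - 1 / γ * (d * Real.log ε) := by
  have h1 : sqDist (ε • (1 : Matrix (Fin d) (Fin d) ℝ)) θ₁ θ = ε * ‖θ₁ - θ‖ ^ 2 := by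
    rw [sqDist, Matrix.smul_mulVec, Matrix.one_mulVec, dotProduct_smul, smul_eq_mul,
      EuclideanSpace.real_norm_sq_eq]
    simp only [dotProduct, ← sq]
  have h2 : ‖θ₁ - θ‖ ≤ 2 * B₁ := (norm_sub_le _ _).trans (by linarith)
  have h3 : ‖θ₁ - θ‖ ^ 2 ≤ (2 * B₁) ^ 2 := pow_le_pow_left₀ (norm_nonneg _) h2 2
  simp only [onsPotential, onsState, h1, Matrix.det_smul, Matrix.det_one, mul_one, Real.log_pow,
    Fintype.card_fin]
  gcongr

end Invariants

/-- Regret bound for the Online-Newton-Step pricing in terms of the potential. -/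
lemma integral_regret_le {F : ℝ → ℝ} {B : ℝ} {d : ℕ} (hF : RegularNoise F)
    {μ : Measure ℝ} [IsProbabilityMeasure μ] (hcdf : ∀ y, F y = cdf μ y) {c γ ε C : ℝ}
    (hc0 : 0 < c)
    (hc : ∀ w ∈ Set.Icc (-B) (B + greedyPrice F 0), ∀ w' ∈ Set.Icc (-B) (B + greedyPrice F 0),
      c * (w' - w) ^ 2 ≤
        (F w' * (deriv F w / F w) - (1 - F w') * (deriv F w / (1 - F w))) * (w' - w))
    (hγ : 0 < γ) (hγc : γ * Cexp F B ≤ c) (hε : 0 < ε) (hC0 : 0 < C)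
    (hC : ∀ u ∈ Set.Icc 0 B, ∀ u' ∈ Set.Icc 0 B,
      (⨆ v : ℝ, expReward F v u') - expReward F (greedyPrice F u) u' ≤ C * (u - u') ^ 2)
    {H : Set (Vec d)} (hH : IsCompact H) (hconv : Convex ℝ H) {θ θ₁ : Vec d} (hθ : θ ∈ H)
    (hθ₁ : θ₁ ∈ H) {x : ℕ → Vec d}
    (hx : ∀ t, ∀ θ ∈ H, 0 ≤ inner ℝ (x t) θ ∧ inner ℝ (x t) θ ≤ B)
    {Ω : Type*} [MeasurableSpace Ω] {P : Measure Ω} [IsProbabilityMeasure P] {N : ℕ → Ω → ℝ}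
    (hN : ∀ t, Measurable (N t)) (hind : iIndepFun N P) (hμ : ∀ t, P.map (N t) = μ) (T : ℕ) :
    ∫ ω, regret F (onsp F H θ₁ γ ε) x θ (fun t => N t ω) T ∂P ≤
      C / c * (onsPotential γ θ (onsState F H θ₁ γ ε []) - ∫ ω, onsPotential γ θ
        (onsState F H θ₁ γ ε (hist (onsp F H θ₁ γ ε) x θ (fun t => N t ω) T)) ∂P) := by
  set 𝒜 := onsp F H θ₁ γ ε with h𝒜
  let Φ : Transcript d → ℝ := fun h => onsPotential γ θ (onsState F H θ₁ γ ε h)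
  let Ψ : ℕ → Transcript d → ℝ := fun t h =>
    (1 - F (𝒜 (x t) h - inner ℝ (x t) θ)) * Φ ((x t, 𝒜 (x t) h, true) :: h)
      + F (𝒜 (x t) h - inner ℝ (x t) θ) * Φ ((x t, 𝒜 (x t) h, false) :: h)
  let ρ : ℕ → Transcript d → ℝ := fun t h =>
    (⨆ v : ℝ, expReward F v (inner ℝ (x t) θ)) - expReward F (𝒜 (x t) h) (inner ℝ (x t) θ)
  have hint : ∀ (Θ : Transcript d → ℝ) t,
      Integrable (fun ω => Θ (hist 𝒜 x θ (fun i => N i ω) t)) P :=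
    integrable_hist 𝒜 x θ hN
  have hstep : ∀ t, ∫ ω, ρ t (hist 𝒜 x θ (fun i => N i ω) t) ∂P ≤
      C / c * (∫ ω, Φ (hist 𝒜 x θ (fun i => N i ω) t) ∂P
        - ∫ ω, Φ (hist 𝒜 x θ (fun i => N i ω) (t + 1)) ∂P) := by
    intro t
    rw [integral_hist_succ 𝒜 x θ hcdf hF.continuous hN hind hμ Φ t,
      ← integral_sub (hint Φ t) (hint (Ψ t) t), ← integral_const_mul]
    refine integral_mono (hint (ρ t) t) (((hint Φ t).sub (hint (Ψ t) t)).const_mul _) fun ω => ?_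
    set h := hist 𝒜 x θ (fun i => N i ω) t with hh
    have hmem : (onsState F H θ₁ γ ε h).1 ∈ H := onsState_hist_mem hH hθ₁ 𝒜 θ _ t
    have h1 := hF.sq_error_le_potential_drop hc hγ hγc hH hconv hθ hmem
      (onsState_hist_posDef hε 𝒜 θ _ t) (hx t) (v := 𝒜 (x t) h) rfl
    have h2 : ρ t h ≤ C * _ := hC _ (hx t _ hmem) _ (hx t _ hθ)
    calc ρ t h ≤ _ := h2
      _ = C / c * (c * (inner ℝ (x t) (onsState F H θ₁ γ ε h).1 - inner ℝ (x t) θ) ^ 2) := by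
          field_simp
      _ ≤ _ := mul_le_mul_of_nonneg_left h1 (by positivity)
  unfold regret
  rw [integral_finsetSum _ fun t _ => hint (ρ t) t]
  calc _ ≤ ∑ t ∈ Finset.range T, C / c * (∫ ω, Φ (hist 𝒜 x θ (fun i => N i ω) t) ∂P
        - ∫ ω, Φ (hist 𝒜 x θ (fun i => N i ω) (t + 1)) ∂P) :=
        Finset.sum_le_sum fun t _ => hstep t
    _ = _ := by
        rw [← Finset.mul_sum, Finset.sum_range_sub']
        simp [Φ, hist]

/-- In dimension zero there is nothing to learn and the greedy price is optimal. -/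
lemma regret_onsp_eq_zero_of_dim_zero {F : ℝ → ℝ} (hF : RegularNoise F) (H : Set (Vec 0))
    (θ₁ : Vec 0) (γ ε : ℝ) (x : ℕ → Vec 0) (θ : Vec 0) (n : ℕ → ℝ) (T : ℕ) :
    regret F (onsp F H θ₁ γ ε) x θ n T = 0 := by
  refine Finset.sum_eq_zero fun t _ => ?_
  rw [hF.iSup_expReward, onsp, Subsingleton.elim (onsState F H θ₁ γ ε _).1 θ, sub_self]

/-- The step size depends on `B₁` and `B₂` only through their product, which keeps `C_a` a function
of `F` and `B` alone. -/
lemma stepGamma_eq (F : ℝ → ℝ) (α B₁ B₂ : ℝ) :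
    stepGamma F α B₁ B₂ =
      1 / 2 * min (1 / (8 * Real.sqrt (Cexp F (B₁ * B₂)) * (B₁ * B₂))) α := by
  have h : ∀ r : ℝ, 4 * (r * B₂) * (2 * B₁) = 8 * r * (B₁ * B₂) := fun r => by ring
  rw [stepGamma, h]

lemma one_add_mul_le_of_le {T : ℕ} (hT : 2 ≤ T) {r : ℝ} (hr : r ≤ 1 / 2) : 1 + T * r ≤ T := by
  have : (2 : ℝ) ≤ T := by exact_mod_cast hT
  nlinarith

lemma one_le_two_mul_log {T : ℕ} (hT : 2 ≤ T) : 1 ≤ 2 * Real.log T := by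
  have h1 : (2 : ℝ) ≤ T := by exact_mod_cast hT
  have := Real.log_le_log (by norm_num) h1
  linarith [Real.log_two_gt_d9]

end Pricing

end

/-! ### Choice of constants and the final estimate. -/

theorem mainTheorem2 (μ : MeasureTheory.Measure ℝ) [MeasureTheory.IsProbabilityMeasure μ]
    (F : ℝ → ℝ) (hcdf : ∀ y, F y = ProbabilityTheory.cdf μ y)
    (hF : Pricing.NoiseAssumption F) (B : ℝ) (hB : 0 < B) :
    ∃ α : ℝ, 0 < α ∧
      (0 < Pricing.Cdown F B → α = Pricing.Cdown F B / Pricing.Cexp F B) ∧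
      ∃ C_a : ℝ, 0 < C_a ∧
        ∀ (B₁ B₂ : ℝ), 0 < B₁ → 0 < B₂ → B₁ * B₂ = B →
        ∀ (d : ℕ) (H D : Set (Pricing.Vec d)),
          Convex ℝ H → IsClosed H → (∀ θ ∈ H, ‖θ‖ ≤ B₁) →
          (∀ x ∈ D, ‖x‖ ≤ B₂) →
          (∀ x ∈ D, ∀ θ ∈ H, 0 ≤ inner ℝ x θ ∧ inner ℝ x θ ≤ B) →
        ∀ (θstar θ₁ : Pricing.Vec d), θstar ∈ H → θ₁ ∈ H →
        ∀ x : ℕ → Pricing.Vec d, (∀ t, x t ∈ D) →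
        ∀ (Ω : Type*) [MeasurableSpace Ω] (P : MeasureTheory.Measure Ω)
          [MeasureTheory.IsProbabilityMeasure P] (N : ℕ → Ω → ℝ),
          (∀ t, Measurable (N t)) → ProbabilityTheory.iIndepFun N P →
          (∀ t, P.map (N t) = μ) →
        ∀ T : ℕ, 2 ≤ T →
          let γ := Pricing.stepGamma F α B₁ B₂
          let ε := Pricing.initEps γ B₁
          MeasureTheory.Integrable (fun ω => Pricing.regret F (Pricing.onsp F H θ₁ γ ε) x θstar
            (fun t => N t ω) T) P ∧
          ∫ ω, Pricing.regret F (Pricing.onsp F H θ₁ γ ε) x θstar (fun t => N t ω) T ∂P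
            ≤ C_a * d * Real.log T := by
  have hR : Pricing.RegularNoise F :=
    { hF with
      pos := fun y => ((hcdf (y - 1)).symm ▸ ProbabilityTheory.cdf_nonneg μ (y - 1) :
        0 ≤ F (y - 1)).trans_lt (hF.strictMono (sub_one_lt y))
      lt_one := fun y => (hF.strictMono (lt_add_one y)).trans_le
        ((hcdf (y + 1)).symm ▸ ProbabilityTheory.cdf_le_one μ (y + 1)) }
  obtain ⟨c, hc0, hcdown, hc⟩ := hR.exists_score_lower_bound hB
  obtain ⟨C, hC0, hC⟩ := hR.exists_reward_gap_le B
  have hE := hR.Cexp_pos hB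
  have hα : 0 < c / Pricing.Cexp F B := div_pos hc0 hE
  have hsqrt := Real.sqrt_pos.2 hE
  set E := Pricing.Cexp F B with hEdef
  set γ₀ := 1 / 2 * min (1 / (8 * Real.sqrt E * B)) (c / E) with hγ₀
  have hγ : 0 < γ₀ := by positivity
  -- The potential drops by at most `(1 + d log (m / ε)) / γ₀` on average. The factor `3` comes from
  -- `m / ε ≤ T` and `1 ≤ 2 log T`.
  refine ⟨c / E, hα, fun h => by rw [← hcdown h], 3 * C / (c * γ₀), by positivity, ?_⟩
  intro B₁ B₂ hB₁ hB₂ hBB d H D hconv hclosed hHn hDn hDH θ θ₁ hθ hθ₁ x hxD Ω _ P _ N hN hind hμ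
    T hT
  have hγeq : Pricing.stepGamma F (c / E) B₁ B₂ = γ₀ := by
    rw [Pricing.stepGamma_eq, hBB]
  rw [hγeq]
  intro γ ε
  have hε : 0 < ε := by
    change 0 < 1 / (γ₀ ^ 2 * (2 * B₁) ^ 2)
    positivity
  have hH : IsCompact H := Metric.isCompact_of_isClosed_isBounded hclosed
    (isBounded_iff_forall_norm_le.2 ⟨B₁, hHn⟩)
  refine ⟨MeasureTheory.integrable_finsetSum _ fun t _ =>
    Pricing.integrable_hist (Pricing.onsp F H θ₁ γ ε) x θ hN (fun h =>
      (⨆ v : ℝ, Pricing.expReward F v (inner ℝ (x t) θ)) -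
        Pricing.expReward F (Pricing.onsp F H θ₁ γ ε (x t) h) (inner ℝ (x t) θ)) t, ?_⟩
  rcases Nat.eq_zero_or_pos d with rfl | hd
  · simp [Pricing.regret_onsp_eq_zero_of_dim_zero hR]
  have hγc : γ₀ * E ≤ c := by
    have h1 : γ₀ ≤ c / E := by
      rw [hγ₀]
      linarith [min_le_right (1 / (8 * Real.sqrt E * B)) (c / E)]
    exact (le_div_iff₀ hE).1 h1
  refine (Pricing.integral_regret_le hR hcdf hc0 hc hγ hγc hε hC0 hC hH hconv hθ hθ₁
    (fun t => hDH _ (hxD t)) hN hind hμ T).trans ?_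
  set m := ε + T * (E * B₂ ^ 2) with hm
  have hfinal : -∫ ω, Pricing.onsPotential γ₀ θ (Pricing.onsState F H θ₁ γ₀ ε
      (Pricing.hist (Pricing.onsp F H θ₁ γ₀ ε) x θ (fun t => N t ω) T)) ∂P ≤
      1 / γ₀ * (d * Real.log m) := by
    rw [← MeasureTheory.integral_neg]
    refine (MeasureTheory.integral_mono ((Pricing.integrable_hist
        (Pricing.onsp F H θ₁ γ₀ ε) x θ hN
        (fun h => Pricing.onsPotential γ₀ θ (Pricing.onsState F H θ₁ γ₀ ε h)) T).neg)
      (MeasureTheory.integrable_const _) fun ω => Pricing.neg_onsPotential_hist_le hR hd hγ hε hH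
        hθ₁ (fun t => hDn _ (hxD t)) (fun t => hDH _ (hxD t)) hE.le θ _ T).trans ?_
    simp [hm, ← hEdef]
  have hinit := Pricing.onsPotential_init (F := F) (H := H) hγ hε (hHn _ hθ) (hHn _ hθ₁)
  -- The choice of `ε` puts the initial distance term on the scale `1 / γ₀` of the `log det` term.
  have hεΔ : γ₀ * (ε * (2 * B₁) ^ 2) = 1 / γ₀ := by
    change γ₀ * (1 / (γ₀ ^ 2 * (2 * B₁) ^ 2) * (2 * B₁) ^ 2) = 1 / γ₀
    field_simp
  have hratio : Real.log m - Real.log ε ≤ Real.log T := by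
    have hm0 : 0 < m := by positivity
    rw [← Real.log_div hm0.ne' hε.ne']
    refine Real.log_le_log (by positivity) ?_
    have h1 : m / ε = 1 + T * (4 * (γ₀ * Real.sqrt E * B) ^ 2) := by
      have h2 : 1 / ε = γ₀ ^ 2 * (2 * B₁) ^ 2 := one_div_one_div _
      have h3 : m / ε = 1 + T * (E * B₂ ^ 2) * (1 / ε) := by
        rw [hm]
        field_simp
      have h7 : (γ₀ * Real.sqrt E * B) ^ 2 = γ₀ ^ 2 * E * (B₁ * B₂) ^ 2 := by
        calc _ = γ₀ ^ 2 * Real.sqrt E ^ 2 * B ^ 2 := by ring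
          _ = _ := by rw [Real.sq_sqrt hE.le, hBB]
      rw [h3, h2, h7]
      ring
    rw [h1]
    refine Pricing.one_add_mul_le_of_le hT ?_
    -- This is the purpose of the cap `1 / (4 G Δ)` in the step size: the per-round growth of `m /
    -- ε` is at most `4 / 256`, well below the `1 / 2` needed for `m / ε ≤ T`.
    have h4 : γ₀ * Real.sqrt E * B ≤ 1 / 16 := by
      have h5 : γ₀ ≤ 1 / 2 * (1 / (8 * Real.sqrt E * B)) :=
        mul_le_mul_of_nonneg_left (min_le_left _ _) (by norm_num)
      calc _ = γ₀ * (Real.sqrt E * B) := by ring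
        _ ≤ 1 / 2 * (1 / (8 * Real.sqrt E * B)) * (Real.sqrt E * B) := by gcongr
        _ = 1 / 16 := by field_simp; norm_num
    have h6 : 0 < γ₀ * Real.sqrt E * B := by positivity
    nlinarith
  have hlog := Pricing.one_le_two_mul_log hT
  have hd1 : (1 : ℝ) ≤ d := by exact_mod_cast hd
  have hsum : 1 + d * (Real.log m - Real.log ε) ≤ 3 * (d * Real.log T) := by
    nlinarith [mul_le_mul_of_nonneg_left hratio (Nat.cast_nonneg (α := ℝ) d)]
  calc _ ≤ C / c * (1 / γ₀ * (1 + d * (Real.log m - Real.log ε))) := by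
        refine mul_le_mul_of_nonneg_left ?_ (by positivity)
        linarith
    _ ≤ C / c * (1 / γ₀ * (3 * (d * Real.log T))) := by gcongr
    _ = _ := by field_simp
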